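/- For a permutation $\pi=\pi_1\cdots\pi_n$ of $\{1,\dots,n\}$ put $\pi_0=\pi_{n+1}=+\infty$. An index $i\in\{1,\dots,n\}$ is a descent of $\pi$ if $\pi_i>\pi_{i+1}$, and a double descent if $\pi_{i-1}>\pi_i>\pi_{i+1}$; let $\mathrm{des}(\pi)$ and $\mathrm{dd}(\pi)$ be the numbers of descents and of double descents of $\pi$. Let $\mathfrak{S}_n(2413,3142)$ be the set of separable permutations of $\{1,\dots,n\}$, that is, those that avoid the patterns $2413$ and $3142$. A nonzero polynomial $p(t)=a_rt^r+\cdots+a_st^s\in\mathbb{Z}[t]$ with $a_r\neq 0\neq a_s$ is palindromic of darga $m$ if $r+s=m$ and $a_{r+i}=a_{s-i}$ for $0\le i\le s-r$; it is $\gamma$-positive of darga $m$ if moreover $p(t)=\sum_{k=r}^{\lfloor m/2\rfloor}\gamma_k t^k(1+t)^{m-2k}$ with nonnegative integers $\gamma_k$. A polynomial $\sum_{i=0}^d h_it^i$ of degree $d$ is unimodal if $h_0\le\cdots\le h_c\ge\cdots\ge h_d$ for some $c$. Theorem. For every integer $n\ge 1$, $$S_n(t):=\sum_{\pi\in\mathfrak{S}_n(2413,3142)}t^{\mathrm{des}(\pi)}=\sum_{k=0}^{\lfloor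 (n-1)/2\rfloor}\gamma_{n,k}^S\,t^k(1+t)^{n-1-2k},$$ where $$\gamma_{n,k}^S=\#\{\pi\in\mathfrak{S}_n(2413,3142):\ \mathrm{dd}(\pi)=0,\ \mathrm{des}(\pi)=k\}.$$ In particular, $S_n(t)$ is $\gamma$-positive of darga $n-1$, palindromic of darga $n-1$, and unimodal. -/

import Mathlib

open Polynomial

namespace DescentPoly

/-- The permutation `π` contains the pattern `σ`: some (not necessarily consecutive) subsequence of
the entries of `π`, at positions `f 0 < f 1 < ⋯`, has the same relative order as `σ`. -/
def Contains {n m : ℕ} (π : Equiv.Perm (Fin n)) (σ : Equiv.Perm (Fin m)) : Prop :=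
  ∃ f : Fin m → Fin n, (∀ a b, a < b → f a < f b) ∧ ∀ a b, π (f a) < π (f b) ↔ σ a < σ b

instance {n m : ℕ} (π : Equiv.Perm (Fin n)) (σ : Equiv.Perm (Fin m)) :
    Decidable (Contains π σ) :=
  inferInstanceAs (Decidable (∃ f : Fin m → Fin n,
    (∀ a b, a < b → f a < f b) ∧ ∀ a b, π (f a) < π (f b) ↔ σ a < σ b))

/-- The pattern 2413, with positions and values counted from 0. -/
def p2413 : Equiv.Perm (Fin 4) := ⟨![1, 3, 0, 2], ![2, 0, 3, 1], by decide, by decide⟩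

/-- The pattern 3142, with positions and values counted from 0. -/
def p3142 : Equiv.Perm (Fin 4) := ⟨![2, 0, 3, 1], ![1, 3, 0, 2], by decide, by decide⟩

/-- The finite set of separable permutations of length `n`: those avoiding 2413 and 3142. -/
def separable (n : ℕ) : Finset (Equiv.Perm (Fin n)) :=
  Finset.univ.filter fun π => ¬ Contains π p2413 ∧ ¬ Contains π p3142

/-- The entry `π_i` of the word `π_1 ⋯ π_n` (positions and values counted from 1), with the
convention `π_i = +∞` for `i` outside `{1, …, n}`, in particular `π_0 = π_{n+1} = +∞`. -/
def entry {n : ℕ} (π : Equiv.Perm (Fin n)) (i : ℕ) : WithTop ℕ :=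
  if h : 1 ≤ i ∧ i ≤ n then (((π ⟨i - 1, by omega⟩ : Fin n) : ℕ) + 1 : ℕ) else ⊤

/-- The number of descents: indices `i ∈ {1, …, n}` with `π_i > π_{i+1}`. -/
def des {n : ℕ} (π : Equiv.Perm (Fin n)) : ℕ :=
  ((Finset.Icc 1 n).filter fun i => entry π (i + 1) < entry π i).card

/-- The number of double descents: indices `i ∈ {1, …, n}` with `π_{i-1} > π_i > π_{i+1}`. -/
def dd {n : ℕ} (π : Equiv.Perm (Fin n)) : ℕ :=
  ((Finset.Icc 1 n).filter fun i =>
    entry π i < entry π (i - 1) ∧ entry π (i + 1) < entry π i).card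

/-- The descent polynomial `S_n(t)` of separable permutations. -/
noncomputable def sepPoly (n : ℕ) : ℤ[X] :=
  ∑ π ∈ separable n, X ^ des π

/-- The number of separable permutations of length `n` with no double descents and `k` descents. -/
def gammaS (n k : ℕ) : ℕ :=
  ((separable n).filter fun π => dd π = 0 ∧ des π = k).card

/-- `p = a_r t^r + ⋯ + a_s t^s` with `a_r ≠ 0`, `a_s ≠ 0` is palindromic of darga `m`:
`r + s = m` and `a_{r+i} = a_{s-i}` for all `0 ≤ i ≤ s - r`. -/
def IsPalindromic (m : ℕ) (p : ℤ[X]) : Prop :=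
  p ≠ 0 ∧ p.natTrailingDegree + p.natDegree = m ∧
    ∀ i ≤ p.natDegree - p.natTrailingDegree,
      p.coeff (p.natTrailingDegree + i) = p.coeff (p.natDegree - i)

/-- `p` is γ-positive of darga `m`: it is palindromic of darga `m`, and the coefficients of its
expansion `∑_{k=r}^{⌊m/2⌋} γ_k t^k (1+t)^{m-2k}` are nonnegative integers. -/
def IsGammaPositive (m : ℕ) (p : ℤ[X]) : Prop :=
  IsPalindromic m p ∧ ∃ γ : ℕ → ℤ, (∀ k, 0 ≤ γ k) ∧
    p = ∑ k ∈ Finset.Icc p.natTrailingDegree (m / 2), C (γ k) * X ^ k * (1 + X) ^ (m - 2 * k)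

/-- The coefficients `h_0, …, h_d` of `p`, where `d` is the degree, first increase and then
decrease (both weakly). -/
def IsUnimodal (p : ℤ[X]) : Prop :=
  ∃ c ≤ p.natDegree, (∀ i < c, p.coeff i ≤ p.coeff (i + 1)) ∧
    ∀ i, c ≤ i → i < p.natDegree → p.coeff (i + 1) ≤ p.coeff i

end DescentPoly

namespace SeparablePerm

open DescentPoly

/-! Every separable permutation of length at least 2 is either a direct sum or a skew sum of shorter
separable ones, never both (`exists_isCut`, `not_isCut_neg`). Splitting off the first indecomposable
block makes the decomposition unique. The descent word of a direct sum is the concatenation of the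
two descent words with a `false` inserted, and that of a skew sum has a `true` instead. Hence every
weight of descent words that is multiplicative under such insertions (`IsSplitting`) gives a system
of algebraic equations between generating functions.

Two weights are compared. If ascents weigh q and descents r, the series satisfies S = x(1 + (q+r)S +
qrS²) + qrS³ (`totalSeries_letterWeight_cubic`). If moreover words with double descents get weight
0, it satisfies the same equation with q in place of q+r (`totalSeries_noRunWeight_cubic`). Such a
cubic has only one solution without constant term (`eq_of_cubic`), so weights (1, t) on all
separable permutations give the same sum as weights (1+t, t/(1+t)) on those without double descents.
A permutation of the second kind with k descents contributes t^k (1+t)^(n-1-2k), which is the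
γ-expansion. The remaining claims follow from the expansion and γ₀ > 0. -/

/-! ### Cuts of words avoiding 2413 and 3142 -/

/-- The word `f 0, …, f (n - 1)` avoids the patterns 2413 and 3142. -/
def Avoids (n : ℕ) (f : ℕ → ℤ) : Prop :=
  ∀ a b c d, a < b → b < c → c < d → d < n →
    ¬ (f c < f a ∧ f a < f d ∧ f d < f b) ∧ ¬ (f b < f d ∧ f d < f a ∧ f a < f c)

/-- The first `k` entries of the word `f 0, …, f (n - 1)` are smaller than the other ones. -/
def IsCut (n : ℕ) (f : ℕ → ℤ) (k : ℕ) : Prop :=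
  0 < k ∧ k < n ∧ ∀ i j, i < k → k ≤ j → j < n → f i < f j

theorem Avoids.neg {n : ℕ} {f : ℕ → ℤ} (h : Avoids n f) : Avoids n (fun i => - f i) := by
  intro a b c d hab hbc hcd hd
  have := h a b c d hab hbc hcd hd
  constructor <;> intro h' <;> simp only [neg_lt_neg_iff] at h' <;> tauto

/-- A letter `f n` is appended to a word with cut `k`. If it exceeds the first block, `k` is still a
cut. Otherwise let `l < k` be the first position with `f l > f n`. An entry below `f n` at `j` with
`l < j < k` would make `l, j, k, n` an occurrence of 3142, so all entries from `l` on exceed `f n`.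
Thus `l` is a cut if `l > 0`, and `f n` is the minimum, a skew cut at `n`, if `l = 0`. -/
theorem exists_isCut_succ {n k : ℕ} {f : ℕ → ℤ} (hinj : Set.InjOn f (Set.Iio (n + 1)))
    (h : Avoids (n + 1) f) (hk : IsCut n f k) :
    ∃ l, IsCut (n + 1) f l ∨ IsCut (n + 1) (fun i => - f i) l := by
  classical
  obtain ⟨hk0, hkn, hcut⟩ := hk
  by_cases hall : ∀ i < k, f i < f n
  · refine ⟨k, Or.inl ⟨hk0, by omega, fun i j hi hj hjn => ?_⟩⟩
    rcases Nat.lt_succ_iff_lt_or_eq.1 hjn with hj' | rfl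
    · exact hcut i j hi hj hj'
    · exact hall i hi
  · have hex : ∃ i, i < k ∧ f n < f i := by
      push Not at hall
      obtain ⟨i, hi, hle⟩ := hall
      refine ⟨i, hi, lt_of_le_of_ne hle fun he => ?_⟩
      have := hinj (by simp) (by simp; omega) he
      omega
    obtain ⟨hl, hln⟩ := Nat.find_spec hex
    have hmin : ∀ i < Nat.find hex, f i ≤ f n := fun i hi => by
      have := Nat.find_min hex hi
      push Not at this
      exact this (by omega)
    set l := Nat.find hex
    have habove : ∀ j, l ≤ j → j < n → f n < f j := by
      intro j hlj hjn
      rcases le_or_gt k j with hkj | hjk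
      · exact hln.trans (hcut l j hl hkj hjn)
      · by_contra hcon
        have hne : f j ≠ f n := fun he => by
          have := hinj (by simp; omega) (by simp) he
          omega
        have hne' : l ≠ j := by
          rintro he
          rw [← he] at hcon
          exact hcon hln
        have hlt : f j < f n := lt_of_le_of_ne (not_lt.1 hcon) hne
        exact (h l j k n (by omega) hjk hkn (by omega)).2
          ⟨hlt, hln, hcut l k hl le_rfl hkn⟩
    rcases Nat.eq_zero_or_pos l with hl0 | hl0
    · refine ⟨n, Or.inr ⟨by omega, by omega, fun i j hi hj hjn => ?_⟩⟩
      have : j = n := by omega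
      subst this
      simpa using habove i (by omega) hi
    · refine ⟨l, Or.inl ⟨hl0, by omega, fun i j hi hj hjn => ?_⟩⟩
      have hin : f i < f n := lt_of_le_of_ne (hmin i hi) fun he => by
        have := hinj (by simp; omega) (by simp) he
        omega
      rcases Nat.lt_succ_iff_lt_or_eq.1 hjn with hj' | rfl
      · exact hin.trans (habove j hj hj')
      · exact hin

theorem exists_isCut {n : ℕ} (hn : 2 ≤ n) {f : ℕ → ℤ} (hinj : Set.InjOn f (Set.Iio n))
    (h : Avoids n f) : ∃ l, IsCut n f l ∨ IsCut n (fun i => - f i) l := by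
  induction n, hn using Nat.le_induction with
  | base =>
    have hne : f 0 ≠ f 1 := fun he => by simpa using hinj (by simp) (by simp) he
    refine ⟨1, ?_⟩
    rcases lt_or_gt_of_ne hne with hlt | hlt
    · refine Or.inl ⟨by omega, by omega, fun i j hi hj hjn => ?_⟩
      obtain rfl : i = 0 := by omega
      obtain rfl : j = 1 := by omega
      exact hlt
    · refine Or.inr ⟨by omega, by omega, fun i j hi hj hjn => ?_⟩
      obtain rfl : i = 0 := by omega
      obtain rfl : j = 1 := by omega
      simpa using hlt
  | succ n hn ih =>
    obtain ⟨k, hk | hk⟩ := ih (hinj.mono (Set.Iio_subset_Iio (by omega)))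
      (fun a b c d hab hbc hcd hd => h a b c d hab hbc hcd (by omega))
    · exact exists_isCut_succ hinj h hk
    -- Negation exchanges the two patterns and the two kinds of cut.
    · obtain ⟨l, hl⟩ := exists_isCut_succ (f := fun i => - f i)
        (fun x hx y hy hxy => hinj hx hy (neg_injective hxy)) h.neg hk
      exact ⟨l, by simpa using hl.symm⟩

/-- A cut forces the first entry below the last one, a skew cut the opposite. -/
theorem not_isCut_neg {n k l : ℕ} {f : ℕ → ℤ} (hk : IsCut n f k) :
    ¬ IsCut n (fun i => - f i) l := by
  rintro ⟨hl0, hln, hl⟩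
  obtain ⟨hk0, hkn, hk⟩ := hk
  have h1 := hk 0 (n - 1) hk0 (by omega) (by omega)
  have h2 := hl 0 (n - 1) hl0 (by omega) (by omega)
  simp only at h2
  omega

/-! ### Permutations as words, and pattern avoidance -/

/-- The word of values of a permutation, counted from 0. -/
def word {n : ℕ} (π : Equiv.Perm (Fin n)) (i : ℕ) : ℤ :=
  if h : i < n then ((π ⟨i, h⟩ : Fin n) : ℕ) else 0

theorem word_of_lt {n : ℕ} (π : Equiv.Perm (Fin n)) {i : ℕ} (h : i < n) :
    word π i = ((π ⟨i, h⟩ : Fin n) : ℕ) := dif_pos h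

theorem word_val {n : ℕ} (π : Equiv.Perm (Fin n)) (i : Fin n) :
    word π i = ((π i : Fin n) : ℕ) := word_of_lt π i.2

theorem word_nonneg {n : ℕ} (π : Equiv.Perm (Fin n)) (i : ℕ) : 0 ≤ word π i := by
  unfold word; split_ifs <;> positivity

theorem word_lt {n : ℕ} (π : Equiv.Perm (Fin n)) {i : ℕ} (h : i < n) : word π i < n := by
  rw [word_of_lt π h]; exact_mod_cast (π ⟨i, h⟩).2

theorem word_injOn {n : ℕ} (π : Equiv.Perm (Fin n)) : Set.InjOn (word π) (Set.Iio n) := by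
  intro i hi j hj h
  rw [word_of_lt π hi, word_of_lt π hj] at h
  exact Fin.mk.inj (π.injective (Fin.ext (by exact_mod_cast h)))

theorem word_ext {n : ℕ} {π σ : Equiv.Perm (Fin n)} (h : ∀ i < n, word π i = word σ i) :
    π = σ := by
  ext i
  have := h i i.2
  rw [word_val, word_val] at this
  exact_mod_cast this

theorem contains_iff_of_val {n : ℕ} (π : Equiv.Perm (Fin n)) (σ : Equiv.Perm (Fin 4)) :
    Contains π σ ↔ ∃ a b c d, a < b ∧ b < c ∧ c < d ∧ d < n ∧
      ∀ i j : Fin 4, word π (![a, b, c, d] i) < word π (![a, b, c, d] j) ↔ σ i < σ j := by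
  constructor
  · rintro ⟨f, hf, h⟩
    refine ⟨f 0, f 1, f 2, f 3, hf 0 1 (by decide), hf 1 2 (by decide), hf 2 3 (by decide),
      (f 3).2, fun i j => ?_⟩
    have key : ∀ i : Fin 4, (![(f 0 : ℕ), f 1, f 2, f 3] : Fin 4 → ℕ) i = f i := by
      intro i; fin_cases i <;> rfl
    rw [key, key, word_val, word_val, ← h i j]
    simp
  · rintro ⟨a, b, c, d, hab, hbc, hcd, hd, h⟩
    have hlt : ∀ i : Fin 4, (![a, b, c, d] : Fin 4 → ℕ) i < n := by
      intro i; fin_cases i <;> simp <;> omega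
    refine ⟨fun i => ⟨_, hlt i⟩, fun i j hij => ?_, fun i j => ?_⟩
    · rw [Fin.mk_lt_mk]
      fin_cases i <;> fin_cases j <;> simp at hij ⊢ <;> omega
    · rw [← h i j, word_of_lt π (hlt i), word_of_lt π (hlt j)]
      simp

theorem contains_p2413_iff {n : ℕ} (π : Equiv.Perm (Fin n)) :
    Contains π p2413 ↔ ∃ a b c d, a < b ∧ b < c ∧ c < d ∧ d < n ∧
      word π c < word π a ∧ word π a < word π d ∧ word π d < word π b := by
  have h0 : p2413 0 = 1 := rfl
  have h1 : p2413 1 = 3 := rfl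
  have h2 : p2413 2 = 0 := rfl
  have h3 : p2413 3 = 2 := rfl
  rw [contains_iff_of_val]
  refine exists_congr fun a => exists_congr fun b => exists_congr fun c => exists_congr fun d =>
    and_congr_right fun _ => and_congr_right fun _ => and_congr_right fun _ =>
    and_congr_right fun _ => ⟨fun h => ?_, fun h i j => ?_⟩
  · exact ⟨(h 2 0).2 (by decide), (h 0 3).2 (by decide), (h 3 1).2 (by decide)⟩
  · fin_cases i <;> fin_cases j <;> simp [h0, h1, h2, h3] <;> omega

theorem contains_p3142_iff {n : ℕ} (π : Equiv.Perm (Fin n)) :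
    Contains π p3142 ↔ ∃ a b c d, a < b ∧ b < c ∧ c < d ∧ d < n ∧
      word π b < word π d ∧ word π d < word π a ∧ word π a < word π c := by
  have h0 : p3142 0 = 2 := rfl
  have h1 : p3142 1 = 0 := rfl
  have h2 : p3142 2 = 3 := rfl
  have h3 : p3142 3 = 1 := rfl
  rw [contains_iff_of_val]
  refine exists_congr fun a => exists_congr fun b => exists_congr fun c => exists_congr fun d =>
    and_congr_right fun _ => and_congr_right fun _ => and_congr_right fun _ =>
    and_congr_right fun _ => ⟨fun h => ?_, fun h i j => ?_⟩
  · exact ⟨(h 1 3).2 (by decide), (h 3 0).2 (by decide), (h 0 2).2 (by decide)⟩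
  · fin_cases i <;> fin_cases j <;> simp [h0, h1, h2, h3] <;> omega

theorem mem_separable_iff {n : ℕ} (π : Equiv.Perm (Fin n)) :
    π ∈ separable n ↔ Avoids n (word π) := by
  rw [separable, Finset.mem_filter, contains_p2413_iff, contains_p3142_iff]
  constructor
  · rintro ⟨-, h1, h2⟩ a b c d hab hbc hcd hd
    exact ⟨fun h => h1 ⟨a, b, c, d, hab, hbc, hcd, hd, h⟩,
      fun h => h2 ⟨a, b, c, d, hab, hbc, hcd, hd, h⟩⟩
  · intro h
    refine ⟨Finset.mem_univ _, ?_, ?_⟩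
    · rintro ⟨a, b, c, d, hab, hbc, hcd, hd, h'⟩
      exact (h a b c d hab hbc hcd hd).1 h'
    · rintro ⟨a, b, c, d, hab, hbc, hcd, hd, h'⟩
      exact (h a b c d hab hbc hcd hd).2 h'

/-! ### Complements and direct sums -/

/-- The complement `i ↦ n - 1 - π i`. -/
def compl {n : ℕ} (π : Equiv.Perm (Fin n)) : Equiv.Perm (Fin n) := π.trans Fin.revPerm

theorem compl_compl {n : ℕ} (π : Equiv.Perm (Fin n)) : compl (compl π) = π := by
  ext i; simp [compl]

theorem word_compl {n : ℕ} (π : Equiv.Perm (Fin n)) {i : ℕ} (h : i < n) :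
    word (compl π) i = n - 1 - word π i := by
  rw [word_of_lt _ h, word_of_lt _ h]
  simp only [compl, Equiv.trans_apply, Fin.revPerm_apply, Fin.val_rev]
  omega

theorem isCut_word_compl {n k : ℕ} (π : Equiv.Perm (Fin n)) :
    IsCut n (word (compl π)) k ↔ IsCut n (fun i => - word π i) k := by
  refine and_congr_right fun h0 => and_congr_right fun hk => ?_
  refine forall_congr' fun i => forall_congr' fun j => forall_congr' fun hi =>
    forall_congr' fun hj => forall_congr' fun hjn => ?_
  rw [word_compl π (by omega), word_compl π hjn, sub_lt_sub_iff_left, neg_lt_neg_iff]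

theorem compl_mem_separable {n : ℕ} {π : Equiv.Perm (Fin n)} (h : π ∈ separable n) :
    compl π ∈ separable n := by
  rw [mem_separable_iff] at h ⊢
  intro a b c d hab hbc hcd hd
  have := h a b c d hab hbc hcd hd
  rw [word_compl π hd, word_compl π (i := a) (by omega), word_compl π (i := b) (by omega),
    word_compl π (i := c) (by omega)]
  constructor <;> intro h' <;> simp only [sub_lt_sub_iff_left] at h' <;> tauto

/-- The direct sum of two permutations. -/
def oplus {k m : ℕ} (α : Equiv.Perm (Fin k)) (β : Equiv.Perm (Fin m)) :
    Equiv.Perm (Fin (k + m)) :=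
  finSumFinEquiv.permCongr (Equiv.Perm.sumCongr α β)

theorem word_oplus_left {k m : ℕ} (α : Equiv.Perm (Fin k)) (β : Equiv.Perm (Fin m)) {i : ℕ}
    (h : i < k) : word (oplus α β) i = word α i := by
  have hval : oplus α β (Fin.castAdd m ⟨i, h⟩) = Fin.castAdd m (α ⟨i, h⟩) := by
    rw [oplus, Equiv.permCongr_apply, finSumFinEquiv_symm_apply_castAdd]
    simp
  have := word_val (oplus α β) (Fin.castAdd m ⟨i, h⟩)
  rw [hval] at this
  simpa [word_of_lt α h] using this

theorem word_oplus_right {k m : ℕ} (α : Equiv.Perm (Fin k)) (β : Equiv.Perm (Fin m)) {i : ℕ}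
    (h : i < m) : word (oplus α β) (k + i) = k + word β i := by
  have hval : oplus α β (Fin.natAdd k ⟨i, h⟩) = Fin.natAdd k (β ⟨i, h⟩) := by
    rw [oplus, Equiv.permCongr_apply, finSumFinEquiv_symm_apply_natAdd]
    simp
  have := word_val (oplus α β) (Fin.natAdd k ⟨i, h⟩)
  rw [hval] at this
  simpa [word_of_lt β h] using this

theorem oplus_injective {k m : ℕ} {α α' : Equiv.Perm (Fin k)} {β β' : Equiv.Perm (Fin m)}
    (h : oplus α β = oplus α' β') : α = α' ∧ β = β' := by
  constructor
  · refine word_ext fun i hi => ?_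
    rw [← word_oplus_left α β hi, h, word_oplus_left _ _ hi]
  · refine word_ext fun i hi => ?_
    have := word_oplus_right α β hi
    rw [h, word_oplus_right _ _ hi] at this
    omega

theorem isCut_oplus {k m : ℕ} (hk : 0 < k) (hm : 0 < m) (α : Equiv.Perm (Fin k))
    (β : Equiv.Perm (Fin m)) : IsCut (k + m) (word (oplus α β)) k := by
  refine ⟨hk, by omega, fun i j hi hj hjn => ?_⟩
  obtain ⟨j, rfl⟩ := Nat.exists_eq_add_of_le hj
  rw [word_oplus_left _ _ hi, word_oplus_right _ _ (by omega)]
  have := word_lt α hi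
  have := word_nonneg β j
  omega

theorem exists_oplus {k m : ℕ} (π : Equiv.Perm (Fin (k + m)))
    (h : ∀ i j, i < k → k ≤ j → j < k + m → word π i < word π j) :
    ∃ (α : Equiv.Perm (Fin k)) (β : Equiv.Perm (Fin m)), oplus α β = π := by
  have hlt : ∀ i : Fin (k + m), (i : ℕ) < k → (π i : ℕ) < k := by
    intro i hi
    by_contra hcon
    push Not at hcon
    -- The `m` entries after the cut all exceed `π i`, which leaves only values below `k` for it.
    have hsub : (Finset.univ.map (Fin.natAddEmb k : Fin m ↪ Fin (k + m))).map π.toEmbedding ⊆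
        Finset.Ioi (π i) := by
      intro y hy
      simp only [Finset.mem_map, Finset.mem_univ, true_and] at hy
      obtain ⟨_, ⟨j, rfl⟩, rfl⟩ := hy
      have := h i (k + j) hi (by omega) (by omega)
      rw [word_val, word_of_lt _ (by omega)] at this
      rw [Finset.mem_Ioi, Fin.lt_def]
      exact_mod_cast this
    have := Finset.card_le_card hsub
    simp at this
    have := (π i).2
    omega
  have hmem : finSumFinEquiv.symm.permCongr π ∈ (Equiv.Perm.sumCongrHom (Fin k) (Fin m)).range := by
    apply Equiv.Perm.mem_sumCongrHom_range_of_perm_mapsTo_inl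
    rintro _ ⟨a, rfl⟩
    have h1 := hlt (Fin.castAdd m a) a.2
    refine ⟨⟨_, h1⟩, ?_⟩
    apply finSumFinEquiv.injective
    simp [Equiv.permCongr_apply]
  obtain ⟨⟨α, β⟩, hab⟩ := hmem
  refine ⟨α, β, ?_⟩
  simp only [Equiv.Perm.sumCongrHom_apply] at hab
  rw [oplus, hab]
  ext i
  simp [Equiv.permCongr_apply]

/-- Neither 2413 nor 3142 is a direct sum, so no occurrence can straddle the cut. -/
theorem avoids_oplus_iff {k m : ℕ} (α : Equiv.Perm (Fin k)) (β : Equiv.Perm (Fin m)) :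
    Avoids (k + m) (word (oplus α β)) ↔ Avoids k (word α) ∧ Avoids m (word β) := by
  constructor
  · intro h
    constructor
    · intro a b c d hab hbc hcd hd
      have := h a b c d hab hbc hcd (by omega)
      rwa [word_oplus_left _ _ hd, word_oplus_left _ _ (by omega : a < k),
        word_oplus_left _ _ (by omega : b < k), word_oplus_left _ _ (by omega : c < k)] at this
    · intro a b c d hab hbc hcd hd
      have := h (k + a) (k + b) (k + c) (k + d) (by omega) (by omega) (by omega) (by omega)
      rw [word_oplus_right _ _ hd, word_oplus_right _ _ (by omega : a < m),
        word_oplus_right _ _ (by omega : b < m), word_oplus_right _ _ (by omega : c < m)] at this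
      simpa using this
  · rintro ⟨h1, h2⟩ a b c d hab hbc hcd hd
    rcases lt_or_ge d k with hdk | hdk
    · rw [word_oplus_left _ _ hdk, word_oplus_left _ _ (by omega : a < k),
        word_oplus_left _ _ (by omega : b < k), word_oplus_left _ _ (by omega : c < k)]
      exact h1 a b c d hab hbc hcd hdk
    rcases lt_or_ge a k with hak | hak
    · have hcut : ∀ i j, i < k → k ≤ j → j < k + m →
          word (oplus α β) i < word (oplus α β) j :=
        (isCut_oplus (by omega) (by omega) α β).2.2
      have h3 := hcut a d hak hdk hd
      have h4 := hcut a b hak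
      have h5 := hcut a c hak
      have h6 := hcut b c
      have h7 := hcut b d
      have h8 := hcut c d
      constructor <;> rintro ⟨h9, h10, h11⟩ <;>
      · rcases lt_or_ge b k with hb | hb <;> rcases lt_or_ge c k with hc | hc <;>
        simp only [hb, hc, hdk, hd, forall_const] at h4 h5 h6 h7 h8 <;> omega
    · obtain ⟨a, rfl⟩ := Nat.exists_eq_add_of_le hak
      obtain ⟨b, rfl⟩ := Nat.exists_eq_add_of_le (by omega : k ≤ b)
      obtain ⟨c, rfl⟩ := Nat.exists_eq_add_of_le (by omega : k ≤ c)
      obtain ⟨d, rfl⟩ := Nat.exists_eq_add_of_le hdk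
      rw [word_oplus_right _ _ (by omega : d < m), word_oplus_right _ _ (by omega : a < m),
        word_oplus_right _ _ (by omega : b < m), word_oplus_right _ _ (by omega : c < m)]
      simpa using h2 a b c d (by omega) (by omega) (by omega) (by omega)

theorem oplus_mem_separable {k m : ℕ} {α : Equiv.Perm (Fin k)} {β : Equiv.Perm (Fin m)} :
    oplus α β ∈ separable (k + m) ↔ α ∈ separable k ∧ β ∈ separable m := by
  simp only [mem_separable_iff, avoids_oplus_iff]

theorem isCut_oplus_iff {k m l : ℕ} (hl : l < k) (α : Equiv.Perm (Fin k))
    (β : Equiv.Perm (Fin m)) : IsCut (k + m) (word (oplus α β)) l ↔ IsCut k (word α) l := by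
  constructor
  · rintro ⟨h0, -, h⟩
    refine ⟨h0, hl, fun i j hi hj hjk => ?_⟩
    have := h i j hi hj (by omega)
    rwa [word_oplus_left _ _ hjk, word_oplus_left _ _ (by omega : i < k)] at this
  · rintro ⟨h0, -, h⟩
    refine ⟨h0, by omega, fun i j hi hj hjn => ?_⟩
    rcases lt_or_ge j k with hjk | hjk
    · rw [word_oplus_left _ _ hjk, word_oplus_left _ _ (by omega : i < k)]
      exact h i j hi hj hjk
    · exact (isCut_oplus (by omega) (by omega) α β).2.2 i j (by omega) hjk hjn

/-! ### Descent words -/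

/-- The descent word of a permutation: its `i`-th letter tells whether there is a descent
from the `i`-th to the next entry. -/
def descWord {n : ℕ} (π : Equiv.Perm (Fin n)) : List Bool :=
  (List.range (n - 1)).map fun i => decide (word π (i + 1) < word π i)

theorem length_descWord {n : ℕ} (π : Equiv.Perm (Fin n)) : (descWord π).length = n - 1 := by
  simp [descWord]

theorem descWord_one (π : Equiv.Perm (Fin 1)) : descWord π = [] := rfl

theorem descWord_compl {n : ℕ} (π : Equiv.Perm (Fin n)) :
    descWord (compl π) = (descWord π).map not := by
  rw [descWord, descWord, List.map_map]
  refine List.map_congr_left fun i hi => ?_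
  rw [List.mem_range] at hi
  have hne : word π (i + 1) ≠ word π i := fun he => by
    have := word_injOn π (by simp; omega) (by simp; omega) he
    omega
  rw [word_compl π (by omega), word_compl π (by omega)]
  simp only [Function.comp_apply, ← decide_not, decide_eq_decide]
  omega

theorem descWord_oplus {k m : ℕ} (hk : 0 < k) (hm : 0 < m) (α : Equiv.Perm (Fin k))
    (β : Equiv.Perm (Fin m)) :
    descWord (oplus α β) = descWord α ++ false :: descWord β := by
  obtain ⟨k, rfl⟩ := Nat.exists_eq_succ_of_ne_zero hk.ne'
  obtain ⟨m, rfl⟩ := Nat.exists_eq_succ_of_ne_zero hm.ne'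
  have hlen : k.succ + m.succ - 1 = k + (1 + m) := by omega
  rw [descWord, descWord, descWord, hlen, List.range_add, List.range_add, List.map_append,
    List.map_map, List.map_append, List.map_map]
  simp only [Nat.succ_eq_add_one, Nat.add_sub_cancel]
  congr 1
  · refine List.map_congr_left fun i hi => ?_
    rw [List.mem_range] at hi
    rw [word_oplus_left _ _ (by omega), word_oplus_left _ _ (by omega)]
  · have hcut := (isCut_oplus hk hm α β).2.2 k (k + 1) (by omega) (by omega) (by omega)
    have hhead : List.map ((fun i => decide (word (oplus α β) (i + 1) < word (oplus α β) i)) ∘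
        fun x => k + x) (List.range 1) = [false] := by
      simp [List.range_succ]
      exact hcut.le
    rw [hhead]
    simp only [List.singleton_append, List.cons.injEq, true_and]
    refine List.map_congr_left fun i hi => ?_
    rw [List.mem_range] at hi
    simp only [Function.comp_apply]
    rw [show k + (1 + i) + 1 = (k + 1) + (i + 1) by ring,
      show k + (1 + i) = (k + 1) + i by ring,
      word_oplus_right _ _ (by omega), word_oplus_right _ _ (by omega)]
    simp

/-! ### Weighted enumeration by sum and skew decompositions -/

section Sums

variable {R : Type*} [CommRing R]

/-- A weight of descent words with given boundary letters that is multiplicative when a word is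
split at a letter. -/
def IsSplitting (c : Bool → R) (W : Bool → Bool → List Bool → R) : Prop :=
  ∀ a b f u v, W a b (u ++ f :: v) = c f * W a f u * W f b v

/-- The weight obtained by complementing all letters. -/
def complWeight (W : Bool → Bool → List Bool → R) (a b : Bool) (w : List Bool) : R :=
  W (!a) (!b) (w.map not)

theorem IsSplitting.compl {c : Bool → R} {W : Bool → Bool → List Bool → R}
    (h : IsSplitting c W) : IsSplitting (fun f => c (!f)) (complWeight W) := by
  intro a b f u v
  simp only [complWeight, List.map_append, List.map_cons]
  exact h _ _ _ _ _

variable (W : Bool → Bool → List Bool → R)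

open Classical in
/-- The total weight of the nonempty separable permutations of length `n` satisfying `P`. -/
noncomputable def weightSum (a b : Bool) (n : ℕ) (P : Equiv.Perm (Fin n) → Prop) : R :=
  if n = 0 then 0 else ∑ π ∈ separable n with P π, W a b (descWord π)

/-- `π` is a direct sum of two nonempty permutations. -/
def SumDecomposable {n : ℕ} (π : Equiv.Perm (Fin n)) : Prop := ∃ k, IsCut n (word π) k

/-- `π` is a skew sum of two nonempty permutations. -/
def SkewDecomposable {n : ℕ} (π : Equiv.Perm (Fin n)) : Prop :=
  ∃ k, IsCut n (fun i => - word π i) k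

theorem sumDecomposable_compl {n : ℕ} (π : Equiv.Perm (Fin n)) :
    SumDecomposable (compl π) ↔ SkewDecomposable π :=
  exists_congr fun _ => isCut_word_compl π

theorem skewDecomposable_compl {n : ℕ} (π : Equiv.Perm (Fin n)) :
    SkewDecomposable (compl π) ↔ SumDecomposable π := by
  rw [← sumDecomposable_compl, compl_compl]

theorem mem_separable_one (π : Equiv.Perm (Fin 1)) : π ∈ separable 1 := by
  rw [mem_separable_iff]
  intro a b c d
  omega

theorem not_isCut_one {f : ℕ → ℤ} {k : ℕ} : ¬ IsCut 1 f k := by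
  rintro ⟨h1, h2, -⟩
  omega

theorem weightSum_zero (a b : Bool) (P : Equiv.Perm (Fin 0) → Prop) :
    weightSum W a b 0 P = 0 := if_pos rfl

theorem weightSum_congr (a b : Bool) {n : ℕ} {P Q : Equiv.Perm (Fin n) → Prop}
    (h : 0 < n → ∀ π ∈ separable n, P π ↔ Q π) : weightSum W a b n P = weightSum W a b n Q := by
  unfold weightSum
  split_ifs with hn
  · rfl
  · classical
    exact Finset.sum_congr (Finset.filter_congr (h (Nat.pos_of_ne_zero hn))) fun _ _ => rfl

theorem weightSum_or (a b : Bool) {n : ℕ} {P Q : Equiv.Perm (Fin n) → Prop}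
    (h : ∀ π, P π → ¬ Q π) :
    weightSum W a b n (fun π => P π ∨ Q π) = weightSum W a b n P + weightSum W a b n Q := by
  classical
  unfold weightSum
  split_ifs with hn
  · simp
  · rw [← Finset.sum_union (Finset.disjoint_filter.2 fun π _ => h π), ← Finset.filter_or]
    refine Finset.sum_congr ?_ fun _ _ => rfl
    ext π
    simp only [Finset.mem_filter]

theorem weightSum_length_one (a b : Bool) (n : ℕ) :
    weightSum W a b n (fun _ => n = 1) = if n = 1 then W a b [] else 0 := by
  classical
  unfold weightSum
  rcases eq_or_ne n 1 with rfl | hn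
  · have : separable 1 = {1} := by
      ext π
      simp [mem_separable_one, Subsingleton.elim π 1]
    simp [this, descWord_one]
  · simp [hn]

/-- A separable permutation that is not a direct sum has length 1 or is a skew sum, and these cases
exclude each other. -/
theorem weightSum_indecomposable (a b : Bool) (n : ℕ) :
    weightSum W a b n (fun π => ¬ SumDecomposable π) =
      (if n = 1 then W a b [] else 0) + weightSum W a b n SkewDecomposable := by
  rw [← weightSum_length_one, ← weightSum_or]
  · refine weightSum_congr W a b fun hn π hπ => ?_
    rw [mem_separable_iff] at hπ
    constructor
    · intro h
      by_contra! hcon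
      obtain ⟨l, hl | hl⟩ := exists_isCut (by omega) (word_injOn π) hπ
      · exact h ⟨l, hl⟩
      · exact hcon.2 ⟨l, hl⟩
    · rintro (rfl | ⟨k, hk⟩) ⟨l, hl⟩
      · exact not_isCut_one hl
      · exact not_isCut_neg hl hk
  · rintro π rfl ⟨k, hk⟩
    exact not_isCut_one hk

theorem weightSum_true (a b : Bool) (n : ℕ) :
    weightSum W a b n (fun _ => True) =
      (if n = 1 then W a b [] else 0) + weightSum W a b n SumDecomposable +
        weightSum W a b n SkewDecomposable := by
  rw [add_right_comm, ← weightSum_indecomposable, ← weightSum_or]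
  · exact weightSum_congr W a b fun _ π _ => by tauto
  · exact fun π h => h

theorem weightSum_complWeight (a b : Bool) {n : ℕ} (P : Equiv.Perm (Fin n) → Prop) :
    weightSum (complWeight W) a b n P = weightSum W (!a) (!b) n (fun π => P (compl π)) := by
  classical
  unfold weightSum
  split_ifs with hn
  · rfl
  · refine Finset.sum_nbij' compl compl ?_ ?_ ?_ ?_ ?_
    · intro π hπ
      rw [Finset.mem_filter] at hπ ⊢
      exact ⟨compl_mem_separable hπ.1, by simpa only [compl_compl] using hπ.2⟩
    · intro π hπ
      rw [Finset.mem_filter] at hπ ⊢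
      exact ⟨compl_mem_separable hπ.1, hπ.2⟩
    · exact fun π _ => compl_compl π
    · exact fun π _ => compl_compl π
    · intro π _
      rw [descWord_compl, complWeight]

/-- `k` is the least cut of `π`. -/
def IsLeastCut {n : ℕ} (k : ℕ) (π : Equiv.Perm (Fin n)) : Prop :=
  IsCut n (word π) k ∧ ∀ l < k, ¬ IsCut n (word π) l

variable {W} {c : Bool → R}

/-- Cutting at the least cut is a bijection onto pairs whose left component is sum-indecomposable.
The letter at the cut is `false`; it becomes the right boundary of the left factor and the left
boundary of the right factor. -/
theorem weightSum_isLeastCut (hW : IsSplitting c W) (a b : Bool) (k m : ℕ) :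
    weightSum W a b (k + m) (IsLeastCut k) =
      c false * weightSum W a false k (fun π => ¬ SumDecomposable π) *
        weightSum W false b m (fun _ => True) := by
  classical
  -- A cut is never at an end, and `weightSum` vanishes in length 0, so both sides are 0 in the
  -- degenerate cases.
  rcases Nat.eq_zero_or_pos k with rfl | hk
  · rw [weightSum_zero, mul_zero, zero_mul, weightSum, Finset.filter_false_of_mem]
    · simp
    · rintro π - ⟨h, -⟩
      exact h.1.false
  rcases Nat.eq_zero_or_pos m with rfl | hm
  · rw [weightSum_zero, mul_zero, weightSum, Finset.filter_false_of_mem]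
    · simp
    · rintro π - ⟨h, -⟩
      exact h.2.1.false
  rw [weightSum, weightSum, weightSum, if_neg (by omega), if_neg (by omega), if_neg (by omega),
    mul_assoc, Finset.sum_mul_sum, ← Finset.sum_product', Finset.mul_sum]
  symm
  refine Finset.sum_bij (fun p _ => oplus p.1 p.2) ?_ ?_ ?_ ?_
  · rintro ⟨α, β⟩ h
    simp only [Finset.mem_product, Finset.mem_filter, and_true] at h ⊢
    refine ⟨oplus_mem_separable.2 ⟨h.1.1, h.2⟩, isCut_oplus hk hm α β, fun l hl hcut => ?_⟩
    exact h.1.2 ⟨l, (isCut_oplus_iff hl α β).1 hcut⟩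
  · rintro ⟨α, β⟩ - ⟨α', β'⟩ - h
    exact Prod.ext_iff.2 (oplus_injective h)
  · intro π hπ
    rw [Finset.mem_filter] at hπ
    obtain ⟨hs, hcut, hmin⟩ := hπ
    obtain ⟨α, β, rfl⟩ := exists_oplus π hcut.2.2
    rw [oplus_mem_separable] at hs
    refine ⟨(α, β), ?_, rfl⟩
    simp only [Finset.mem_product, Finset.mem_filter, and_true]
    refine ⟨⟨hs.1, ?_⟩, hs.2⟩
    rintro ⟨l, hl⟩
    exact hmin l hl.2.1 ((isCut_oplus_iff hl.2.1 α β).2 hl)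
  · rintro ⟨α, β⟩ -
    rw [descWord_oplus hk hm, hW, mul_assoc]

theorem weightSum_sumDecomposable (hW : IsSplitting c W) (a b : Bool) (n : ℕ) :
    weightSum W a b n SumDecomposable = ∑ p ∈ Finset.HasAntidiagonal.antidiagonal n,
      c false * weightSum W a false p.1 (fun π => ¬ SumDecomposable π) *
        weightSum W false b p.2 (fun _ => True) := by
  classical
  have hsplit : weightSum W a b n SumDecomposable =
      ∑ p ∈ Finset.HasAntidiagonal.antidiagonal n, weightSum W a b n (IsLeastCut p.1) := by
    unfold weightSum
    split_ifs with hn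
    · simp
    -- Fibres over the least cut; the value `(0, n)` is never taken on the permutations summed over.
    · let g : Equiv.Perm (Fin n) → ℕ × ℕ := fun π =>
        if h : SumDecomposable π then (Nat.find h, n - Nat.find h) else (0, n)
      rw [← Finset.sum_fiberwise_of_maps_to (g := g) (t := Finset.HasAntidiagonal.antidiagonal n)]
      · refine Finset.sum_congr rfl fun p hp => Finset.sum_congr ?_ fun _ _ => rfl
        rw [Finset.HasAntidiagonal.mem_antidiagonal] at hp
        ext π
        simp only [Finset.mem_filter, and_assoc]
        refine and_congr_right fun _ => ⟨?_, ?_⟩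
        · rintro ⟨h, hg⟩
          simp only [g, dif_pos h] at hg
          rw [← hg]
          exact ⟨Nat.find_spec h, fun l hl => Nat.find_min h hl⟩
        · rintro ⟨hcut, hmin⟩
          have h : SumDecomposable π := ⟨_, hcut⟩
          have hfind : Nat.find h = p.1 := (Nat.find_eq_iff h).2 ⟨hcut, hmin⟩
          refine ⟨h, ?_⟩
          simp only [g, dif_pos h, hfind]
          ext <;> simp; omega
      · intro π hπ
        rw [Finset.mem_filter] at hπ
        simp only [g, dif_pos hπ.2, Finset.HasAntidiagonal.mem_antidiagonal]
        have := (Nat.find_spec hπ.2).2.1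
        omega
  rw [hsplit]
  refine Finset.sum_congr rfl fun p hp => ?_
  rw [Finset.HasAntidiagonal.mem_antidiagonal] at hp
  obtain ⟨k, m⟩ := p
  subst hp
  exact weightSum_isLeastCut hW a b k m

/-- Complementation turns skew sums into direct sums and flips all letters, so this is the previous
formula for `complWeight W`. -/
theorem weightSum_skewDecomposable (hW : IsSplitting c W) (a b : Bool) (n : ℕ) :
    weightSum W a b n SkewDecomposable = ∑ p ∈ Finset.HasAntidiagonal.antidiagonal n,
      c true * weightSum W a true p.1 (fun π => ¬ SkewDecomposable π) *
        weightSum W true b p.2 (fun _ => True) := by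
  have h := weightSum_sumDecomposable hW.compl (!a) (!b) n
  simpa only [weightSum_complWeight, sumDecomposable_compl, Bool.not_not, Bool.not_false] using h

variable (W)

/-- The generating function of the permutations satisfying `P`. -/
noncomputable def weightSeries (a b : Bool) (P : ∀ n, Equiv.Perm (Fin n) → Prop) :
    PowerSeries R :=
  PowerSeries.mk fun n => weightSum W a b n (P n)

/-- The generating function of all nonempty separable permutations. -/
noncomputable def totalSeries (a b : Bool) : PowerSeries R :=
  weightSeries W a b fun _ _ => True

noncomputable def sumSeries (a b : Bool) : PowerSeries R :=
  weightSeries W a b fun _ => SumDecomposable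

noncomputable def skewSeries (a b : Bool) : PowerSeries R :=
  weightSeries W a b fun _ => SkewDecomposable

theorem constantCoeff_weightSeries (a b : Bool) (P : ∀ n, Equiv.Perm (Fin n) → Prop) :
    PowerSeries.constantCoeff (weightSeries W a b P) = 0 := by
  rw [← PowerSeries.coeff_zero_eq_constantCoeff_apply, weightSeries, PowerSeries.coeff_mk,
    weightSum_zero]

theorem coeff_C_mul_X (r : R) (n : ℕ) :
    PowerSeries.coeff n (PowerSeries.C r * PowerSeries.X : PowerSeries R) =
      if n = 1 then r else 0 := by
  rw [PowerSeries.coeff_C_mul, PowerSeries.coeff_X]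
  split_ifs <;> simp

theorem totalSeries_eq (a b : Bool) :
    totalSeries W a b = PowerSeries.C (W a b []) * PowerSeries.X + sumSeries W a b +
      skewSeries W a b := by
  ext n
  simp only [map_add, coeff_C_mul_X, totalSeries, sumSeries, skewSeries, weightSeries,
    PowerSeries.coeff_mk]
  exact weightSum_true W a b n

variable {W}

theorem sumSeries_eq (hW : IsSplitting c W) (a b : Bool) :
    sumSeries W a b = PowerSeries.C (c false) *
      (PowerSeries.C (W a false []) * PowerSeries.X + skewSeries W a false) *
        totalSeries W false b := by
  ext n
  rw [mul_assoc, PowerSeries.coeff_C_mul, PowerSeries.coeff_mul, sumSeries, weightSeries,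
    PowerSeries.coeff_mk, weightSum_sumDecomposable hW, Finset.mul_sum]
  refine Finset.sum_congr rfl fun p _ => ?_
  rw [weightSum_indecomposable, map_add, coeff_C_mul_X, skewSeries, totalSeries, weightSeries,
    weightSeries, PowerSeries.coeff_mk, PowerSeries.coeff_mk, mul_assoc]

theorem weightSum_skewIndecomposable (a b : Bool) (n : ℕ) :
    weightSum W a b n (fun π => ¬ SkewDecomposable π) =
      (if n = 1 then W a b [] else 0) + weightSum W a b n SumDecomposable := by
  have h := weightSum_indecomposable (complWeight W) (!a) (!b) n
  simpa only [weightSum_complWeight, sumDecomposable_compl, skewDecomposable_compl, complWeight,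
    Bool.not_not, List.map_nil] using h

theorem skewSeries_eq (hW : IsSplitting c W) (a b : Bool) :
    skewSeries W a b = PowerSeries.C (c true) *
      (PowerSeries.C (W a true []) * PowerSeries.X + sumSeries W a true) *
        totalSeries W true b := by
  ext n
  rw [mul_assoc, PowerSeries.coeff_C_mul, PowerSeries.coeff_mul, skewSeries, weightSeries,
    PowerSeries.coeff_mk, weightSum_skewDecomposable hW, Finset.mul_sum]
  refine Finset.sum_congr rfl fun p _ => ?_
  rw [weightSum_skewIndecomposable, map_add, coeff_C_mul_X, sumSeries, totalSeries, weightSeries,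
    weightSeries, PowerSeries.coeff_mk, PowerSeries.coeff_mk, mul_assoc]

end Sums

/-! ### The cubic equations for the two weights -/

section Cubic

variable {K : Type*} [Field K]

theorem eq_of_mul_eq_mul_left {F G H : PowerSeries K} (hF : PowerSeries.constantCoeff F = 1)
    (h : F * G = F * H) : G = H := by
  refine mul_left_cancel₀ (fun h0 => ?_) h
  simp [h0] at hF

/-- The difference of the two equations is `F - G` times a series with constant term 1, which can be
cancelled. -/
theorem eq_of_cubic {q t : K} {F G : PowerSeries K} (hF : PowerSeries.constantCoeff F = 0)
    (hG : PowerSeries.constantCoeff G = 0)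
    (h1 : F = PowerSeries.X * (1 + PowerSeries.C q * F + PowerSeries.C t * F ^ 2) +
      PowerSeries.C t * F ^ 3)
    (h2 : G = PowerSeries.X * (1 + PowerSeries.C q * G + PowerSeries.C t * G ^ 2) +
      PowerSeries.C t * G ^ 3) : F = G := by
  refine eq_of_mul_eq_mul_left (F := 1 - PowerSeries.X * (PowerSeries.C q +
    PowerSeries.C t * (F + G)) - PowerSeries.C t * (F ^ 2 + F * G + G ^ 2)) ?_ ?_
  · simp [hF, hG]
  · linear_combination h1 - h2

/-- The weight of a word as the product of the weights of its letters. -/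
def letterWeight (c : Bool → K) (w : List Bool) : K := (w.map c).prod

theorem isSplitting_letterWeight (c : Bool → K) :
    IsSplitting c fun _ _ w => letterWeight c w := by
  intro a b f u v
  simp only [letterWeight, List.map_append, List.map_cons, List.prod_append, List.prod_cons]
  ring

/-- With P, M the sum and skew series, S = x + P + M, P = q(x + M)S and M = r(x + P)S. Eliminating x
+ M = S - P and x + P = S - M gives P(1 + qS) = qS² and M(1 + rS) = rS²; the cubic is the first
equation times (1 + qS)(1 + rS). -/
theorem totalSeries_letterWeight_cubic (c : Bool → K) (a b : Bool) :
    let S := totalSeries (fun _ _ w => letterWeight c w) a b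
    S = PowerSeries.X * (1 + PowerSeries.C (c false + c true) * S +
      PowerSeries.C (c true * c false) * S ^ 2) + PowerSeries.C (c true * c false) * S ^ 3 := by
  intro S
  have e1 := totalSeries_eq (fun _ _ w => letterWeight c w) a b
  have e2 := sumSeries_eq (isSplitting_letterWeight c) a b
  have e3 := skewSeries_eq (isSplitting_letterWeight c) a b
  change S = _ * _ + sumSeries (fun _ _ w => letterWeight c w) a b +
    skewSeries (fun _ _ w => letterWeight c w) a b at e1
  change sumSeries (fun _ _ w => letterWeight c w) a b =
    _ * (_ + skewSeries (fun _ _ w => letterWeight c w) a b) * S at e2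
  change skewSeries (fun _ _ w => letterWeight c w) a b =
    _ * (_ + sumSeries (fun _ _ w => letterWeight c w) a b) * S at e3
  generalize sumSeries (fun _ _ w => letterWeight c w) a b = P at *
  generalize skewSeries (fun _ _ w => letterWeight c w) a b = M at *
  generalize S = S at *
  have h1 : letterWeight c [] = 1 := by simp [letterWeight]
  simp only [h1, map_one, one_mul, map_mul, map_add] at *
  generalize PowerSeries.C (c false) = q at *
  generalize PowerSeries.C (c true) = r at *
  linear_combination (1 + q * S) * (1 + r * S) * e1 + (1 + r * S) * (e2 - q * S * e1) +
    (1 + q * S) * (e3 - r * S * e1)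

/-- No two consecutive letters of the word are true. -/
def NoRun (w : List Bool) : Prop := w.IsChain fun x y => ¬ (x = true ∧ y = true)

instance (w : List Bool) : Decidable (NoRun w) := by unfold NoRun; infer_instance

/-- The weight of a word that is zero if two consecutive letters, boundary letters included,
are true. -/
def noRunWeight (c : Bool → K) (a b : Bool) (w : List Bool) : K :=
  if NoRun (a :: (w ++ [b])) then letterWeight c w else 0

theorem isSplitting_noRunWeight (c : Bool → K) : IsSplitting c (noRunWeight c) := by
  intro a b f u v
  have hsplit : NoRun (a :: (u ++ f :: v ++ [b])) ↔
      NoRun (a :: (u ++ [f])) ∧ NoRun (f :: (v ++ [b])) := by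
    have := List.isChain_split (R := fun x y : Bool => ¬ (x = true ∧ y = true)) (c := f)
      (l₁ := a :: u) (l₂ := v ++ [b])
    simpa [NoRun] using this
  simp only [noRunWeight, hsplit]
  have := isSplitting_letterWeight c a b f u v
  simp only at this
  by_cases h1 : NoRun (a :: (u ++ [f])) <;> by_cases h2 : NoRun (f :: (v ++ [b])) <;>
    simp [h1, h2, this]

theorem noRunWeight_nil (c : Bool → K) (a b : Bool) :
    noRunWeight c a b [] = if a && b then 0 else 1 := by
  cases a <;> cases b <;> simp [noRunWeight, NoRun, letterWeight]

/-- Elimination of the unknowns other than `A` and `D` from the system of equations for the four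
series of words without runs. -/
theorem cubic_of_system {x q r A B C D PA PB PC PD MA MB MC MD : PowerSeries K}
    (hx : PowerSeries.constantCoeff x = 0) (hA : PowerSeries.constantCoeff A = 0)
    (hD : PowerSeries.constantCoeff D = 0) (hMA : PowerSeries.constantCoeff MA = 0)
    (eA : A = x + PA + MA) (eB : B = PB + MB) (eC : C = x + PC + MC) (eD : D = x + PD + MD)
    (ePA : PA = q * (x + MA) * C) (ePB : PB = q * (x + MA) * D)
    (ePC : PC = q * (x + MC) * C) (ePD : PD = q * (x + MC) * D)
    (eMA : MA = r * PB * A) (eMB : MB = r * PB * B)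
    (eMC : MC = r * (x + PD) * A) (eMD : MD = r * (x + PD) * B) :
    A = x * (1 + q * A + r * q * A ^ 2) + r * q * A ^ 3 := by
  -- The series of indecomposables: `α` and `κ` for direct sums with left boundary `true` and
  -- `false`, `δ` for skew sums.
  obtain ⟨α, hα⟩ : ∃ α, α = x + MA := ⟨_, rfl⟩
  obtain ⟨δ, hδ⟩ : ∃ δ, δ = x + PD := ⟨_, rfl⟩
  obtain ⟨κ, hκ⟩ : ∃ κ, κ = x + MC := ⟨_, rfl⟩
  have cα : PowerSeries.constantCoeff α = 0 := by simp [hα, hx, hMA]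
  rw [← hα] at ePA ePB
  rw [← hδ] at eMC eMD
  rw [← hκ] at ePC ePD
  have h1 : A * (1 - q * κ) = α := by
    have a1 : A = α * (1 + q * C) := by linear_combination eA + ePA - hα
    have a2 : C = κ * (1 + q * C) := by linear_combination eC + ePC - hκ
    linear_combination (1 - q * κ) * a1 + q * α * a2
  have h2 : α * (1 - q * r * A * D) = x := by
    linear_combination hα + eMA + r * A * ePB
  have h3 : δ = α * (1 + q * D) := by
    refine eq_of_mul_eq_mul_left (F := 1 - q * r * A * D) (by simp [hA]) ?_
    linear_combination hδ + ePD + q * D * hκ + q * D * eMC - (1 + q * D) * h2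
  have h4 : D = α * (1 + q * D + q * r * D ^ 2) := by
    have a1 : D = δ * (1 + r * B) := by linear_combination eD + eMD - hδ
    have a2 : B = PB * (1 + r * B) := by linear_combination eB + eMB
    have a3 : D * (1 - r * PB) = δ := by
      linear_combination (1 - r * PB) * a1 + r * δ * a2
    linear_combination a3 + h3 + r * D * ePB
  have h5 : A = α * (1 + q * A + q * r * A ^ 2) := by
    linear_combination h1 + q * A * hκ + q * A * eMC + q * r * A ^ 2 * h3 - q * A * h2
  -- `A` and `D` solve the same quadratic equation over `α`, whose solution is unique because `α`
  -- has no constant term. Combinatorially, reverse-complement reverses the descent word and swaps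
  -- the boundary letters.
  have h6 : A = D := by
    refine eq_of_mul_eq_mul_left (F := 1 - α * (q + q * r * (A + D))) (by simp [cα]) ?_
    linear_combination h5 - h4
  subst h6
  -- With `D = A`, `h2` reads `α * (1 - q * r * A ^ 2) = x`, which eliminates `α` from `h5`.
  linear_combination (1 - q * r * A ^ 2) * h5 + (1 + q * A + q * r * A ^ 2) * h2

/-- The boundary letters `true`, `false` encode π₀ = π_{n+1} = ∞. Splitting produces all four
boundary pairs, hence a system for four total series; for the pair `true`, `true` the single entry
has weight 0. -/
theorem totalSeries_noRunWeight_cubic (c : Bool → K) :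
    let S := totalSeries (noRunWeight c) true false
    S = PowerSeries.X * (1 + PowerSeries.C (c false) * S +
      PowerSeries.C (c true * c false) * S ^ 2) + PowerSeries.C (c true * c false) * S ^ 3 := by
  intro S
  have hs := isSplitting_noRunWeight c
  have ht := totalSeries_eq (noRunWeight c)
  have hP := sumSeries_eq hs
  have hM := skewSeries_eq hs
  have h0 := constantCoeff_weightSeries (noRunWeight c)
  have key := cubic_of_system (x := PowerSeries.X) (q := PowerSeries.C (c false))
    (r := PowerSeries.C (c true)) (A := S) (B := totalSeries (noRunWeight c) true true)
    (C := totalSeries (noRunWeight c) false false) (D := totalSeries (noRunWeight c) false true)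
    (PA := sumSeries (noRunWeight c) true false) (PB := sumSeries (noRunWeight c) true true)
    (PC := sumSeries (noRunWeight c) false false) (PD := sumSeries (noRunWeight c) false true)
    (MA := skewSeries (noRunWeight c) true false) (MB := skewSeries (noRunWeight c) true true)
    (MC := skewSeries (noRunWeight c) false false) (MD := skewSeries (noRunWeight c) false true)
    (by simp) (h0 _ _ _) (h0 _ _ _) (h0 _ _ _)
    (by simpa [noRunWeight_nil] using ht true false)
    (by simpa [noRunWeight_nil] using ht true true)
    (by simpa [noRunWeight_nil] using ht false false)
    (by simpa [noRunWeight_nil] using ht false true)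
    (by simpa [noRunWeight_nil] using hP true false)
    (by simpa [noRunWeight_nil] using hP true true)
    (by simpa [noRunWeight_nil] using hP false false)
    (by simpa [noRunWeight_nil] using hP false true)
    (by simpa [noRunWeight_nil] using hM true false)
    (by simpa [noRunWeight_nil] using hM true true)
    (by simpa [noRunWeight_nil] using hM false false)
    (by simpa [noRunWeight_nil] using hM false true)
  rw [map_mul]
  linear_combination key

/-- Under `h1` and `h2` the two cubics coincide, hence so do the series and their coefficients. -/
theorem sum_letterWeight_eq_sum_noRunWeight {c c' : Bool → K}
    (h1 : c false + c true = c' false) (h2 : c true * c false = c' true * c' false) {n : ℕ}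
    (hn : 1 ≤ n) :
    ∑ π ∈ separable n, letterWeight c (descWord π) =
      ∑ π ∈ separable n, noRunWeight c' true false (descWord π) := by
  have hcoeff : ∀ W : Bool → Bool → List Bool → K, PowerSeries.coeff n (totalSeries W true false) =
      ∑ π ∈ separable n, W true false (descWord π) := by
    intro W
    classical
    rw [totalSeries, weightSeries, PowerSeries.coeff_mk, weightSum, if_neg (by omega)]
    simp
  have e1 := totalSeries_letterWeight_cubic c true false
  have e2 := totalSeries_noRunWeight_cubic c'
  simp only [h1, h2] at e1 e2
  have heq : totalSeries (fun _ _ w => letterWeight c w) true false =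
      totalSeries (noRunWeight c') true false :=
    eq_of_cubic (constantCoeff_weightSeries _ _ _ _) (constantCoeff_weightSeries _ _ _ _)
      e1 e2
  rw [← hcoeff (noRunWeight c'), ← heq, hcoeff]

end Cubic

/-! ### Descents and double descents read off the descent word -/

theorem entry_succ {n : ℕ} (π : Equiv.Perm (Fin n)) {i : ℕ} (h : i < n) :
    entry π (i + 1) = (((π ⟨i, h⟩ : Fin n) : ℕ) + 1 : ℕ) := by
  rw [entry, dif_pos ⟨by omega, by omega⟩]
  rfl

theorem entry_eq_top {n : ℕ} (π : Equiv.Perm (Fin n)) {i : ℕ} (h : ¬ (1 ≤ i ∧ i ≤ n)) :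
    entry π i = ⊤ := dif_neg h

theorem entry_lt_entry_iff {n : ℕ} (π : Equiv.Perm (Fin n)) {i j : ℕ} (hi : i < n) (hj : j < n) :
    entry π (i + 1) < entry π (j + 1) ↔ word π i < word π j := by
  rw [entry_succ π hi, entry_succ π hj, word_of_lt π hi, word_of_lt π hj]
  norm_cast
  omega

theorem count_true_map_range (p : ℕ → Prop) [DecidablePred p] (n : ℕ) :
    ((List.range n).map fun i => decide (p i)).count true = ((Finset.range n).filter p).card := by
  induction n with
  | zero => rfl
  | succ n ih =>
    rw [List.range_succ, List.map_append, List.count_append, ih, Finset.range_add_one,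
      Finset.filter_insert]
    split_ifs with h <;> simp [h]

/-- The descent word with the boundary letters given by the convention `π_0 = π_{n+1} = ∞`. -/
theorem true_cons_descWord_append {n : ℕ} (hn : 1 ≤ n) (π : Equiv.Perm (Fin n)) :
    true :: (descWord π ++ [false]) =
      (List.range (n + 1)).map fun i => decide (entry π (i + 1) < entry π i) := by
  obtain ⟨m, rfl⟩ := Nat.exists_eq_add_of_le' hn
  have h0 : entry π (0 + 1) < entry π 0 := by
    rw [entry_succ π (by omega), entry_eq_top π (i := 0) (by omega)]
    exact WithTop.coe_lt_top _
  have hlast : ¬ entry π (m + 1 + 1) < entry π (m + 1) := by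
    rw [entry_eq_top π (i := m + 1 + 1) (by omega)]
    exact not_top_lt
  rw [List.range_succ_eq_map, List.map_cons, List.map_map, List.range_succ, List.map_append]
  simp only [h0, decide_true, List.map_cons, List.map_nil, Function.comp_apply,
    Nat.succ_eq_add_one, hlast, decide_false]
  congr 2
  refine List.map_congr_left fun i hi => ?_
  rw [Nat.add_sub_cancel, List.mem_range] at hi
  simp only [Function.comp_apply, decide_eq_decide]
  exact (entry_lt_entry_iff π (by omega) (by omega)).symm

theorem des_eq_count {n : ℕ} (hn : 1 ≤ n) (π : Equiv.Perm (Fin n)) :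
    des π = (descWord π).count true := by
  have h := congrArg (List.count true) (true_cons_descWord_append hn π)
  rw [count_true_map_range] at h
  have hIcc : insert 0 (Finset.Icc 1 n) = Finset.range (n + 1) := by
    ext i; simp; omega
  have h0 : entry π (0 + 1) < entry π 0 := by
    rw [entry_succ π (by omega), entry_eq_top π (i := 0) (by omega)]
    exact WithTop.coe_lt_top _
  -- The leading `true` is the descent from π₀ = ∞ at index 0, which `des` does not count.
  rw [← hIcc, Finset.filter_insert, if_pos h0, Finset.card_insert_of_notMem (by simp)] at h
  simp only [List.count_cons_self, List.count_append] at h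
  have : List.count true [false] = 0 := rfl
  rw [des]
  omega

theorem dd_eq_zero_iff {n : ℕ} (hn : 1 ≤ n) (π : Equiv.Perm (Fin n)) :
    dd π = 0 ↔ NoRun (true :: (descWord π ++ [false])) := by
  rw [true_cons_descWord_append hn, NoRun, List.isChain_map, List.isChain_range, dd,
    Finset.card_eq_zero, Finset.filter_eq_empty_iff]
  simp only [decide_eq_true_eq, Finset.mem_Icc, Nat.add_sub_cancel]
  constructor
  · intro h m hm
    simpa using @h (m + 1) ⟨by omega, by omega⟩
  · rintro h i ⟨hi1, hin⟩
    obtain ⟨m, rfl⟩ := Nat.exists_eq_add_of_le' hi1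
    simpa using h m (by omega)

/-- Each `true` is followed by a `false` of its own, the appended last letter included. -/
theorem two_mul_count_le_of_noRun (a : Bool) (w : List Bool) (h : NoRun (a :: (w ++ [false]))) :
    2 * w.count true + a.toNat ≤ w.length + 1 := by
  induction w generalizing a with
  | nil => cases a <;> simp
  | cons f v ih =>
    rw [NoRun, List.cons_append, List.isChain_cons_cons] at h
    have := ih f h.2
    cases a <;> cases f <;> simp at h this ⊢ <;> omega

theorem two_mul_des_le {n : ℕ} (hn : 1 ≤ n) {π : Equiv.Perm (Fin n)} (h : dd π = 0) :
    2 * des π ≤ n - 1 := by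
  have := two_mul_count_le_of_noRun true _ ((dd_eq_zero_iff hn π).1 h)
  rw [length_descWord] at this
  rw [des_eq_count hn]
  simp at this
  omega

/-! ### The γ-expansion of the descent polynomial -/

theorem letterWeight_eq {K : Type*} [Field K] (c : Bool → K) (w : List Bool) :
    letterWeight c w = c true ^ w.count true * c false ^ (w.length - w.count true) := by
  induction w with
  | nil => simp [letterWeight]
  | cons f v ih =>
    have hle := List.count_le_length (a := true) (l := v)
    rw [letterWeight, List.map_cons, List.prod_cons, ← letterWeight, ih]
    cases f
    · rw [List.count_cons_of_ne (by decide), List.length_cons, Nat.succ_sub hle, pow_succ]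
      ring
    · rw [List.count_cons_self, List.length_cons, Nat.add_sub_add_right, pow_succ]
      ring

theorem sum_gammaS_mul {n : ℕ} (hn : 1 ≤ n) (f : ℕ → ℤ[X]) :
    ∑ k ∈ Finset.range ((n - 1) / 2 + 1), C (gammaS n k : ℤ) * f k =
      ∑ π ∈ (separable n).filter (fun π => dd π = 0), f (des π) := by
  rw [← Finset.sum_fiberwise_of_maps_to (g := des) (t := Finset.range ((n - 1) / 2 + 1))]
  · refine Finset.sum_congr rfl fun k _ => ?_
    rw [Finset.sum_congr rfl fun π hπ => congrArg f (Finset.mem_filter.1 hπ).2, Finset.sum_const,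
      Finset.filter_filter, gammaS, nsmul_eq_mul]
    simp
  · intro π hπ
    have := two_mul_des_le hn (Finset.mem_filter.1 hπ).2
    rw [Finset.mem_range]
    omega

theorem sepPoly_eq_sum_filter {n : ℕ} (hn : 1 ≤ n) :
    sepPoly n = ∑ π ∈ (separable n).filter (fun π => dd π = 0),
      X ^ des π * (1 + X) ^ (n - 1 - 2 * des π) := by
  let K := FractionRing ℤ[X]
  let φ : ℤ[X] →+* K := algebraMap ℤ[X] K
  have hinj : Function.Injective φ := IsFractionRing.injective ℤ[X] K
  have hne : (1 + φ X : K) ≠ 0 := by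
    rw [← map_one φ, ← map_add]
    refine (map_ne_zero_iff φ hinj).2 fun h => ?_
    simpa using congrArg (Polynomial.eval 0) h
  apply hinj
  let c : Bool → K := fun f => bif f then φ X else 1
  -- Chosen so that q' = 1 + t and q'r' = t, the sum and product of the weights `c`; the quotient is
  -- why the computation takes place in the fraction field.
  let c' : Bool → K := fun f => bif f then φ X / (1 + φ X) else 1 + φ X
  have key := sum_letterWeight_eq_sum_noRunWeight (c := c) (c' := c') rfl
    (by simp only [c, c', cond_true, cond_false, mul_one, div_mul_cancel₀ _ hne]) hn
  rw [sepPoly, map_sum, map_sum, Finset.sum_filter]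
  convert key using 1
  · refine Finset.sum_congr rfl fun π _ => ?_
    rw [letterWeight_eq, des_eq_count hn]
    simp [c]
  · refine Finset.sum_congr rfl fun π _ => ?_
    simp only [noRunWeight, dd_eq_zero_iff hn]
    split_ifs with h
    · have hle := two_mul_des_le hn ((dd_eq_zero_iff hn π).2 h)
      rw [letterWeight_eq, ← des_eq_count hn, length_descWord,
        show n - 1 - des π = des π + (n - 1 - 2 * des π) by omega]
      simp only [c', cond_true, cond_false, map_mul, map_pow, map_add, map_one, pow_add,
        ← mul_assoc, ← mul_pow, div_mul_cancel₀ _ hne]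
    · rfl

theorem sepPoly_eq {n : ℕ} (hn : 1 ≤ n) :
    sepPoly n = ∑ k ∈ Finset.range ((n - 1) / 2 + 1),
      C (gammaS n k : ℤ) * X ^ k * (1 + X) ^ (n - 1 - 2 * k) := by
  simp only [mul_assoc]
  rw [sepPoly_eq_sum_filter hn, sum_gammaS_mul hn fun k => X ^ k * (1 + X) ^ (n - 1 - 2 * k)]

/-- Witnessed by the identity. This makes the constant and leading coefficients of the polynomial
nonzero, which fixes its degree and darga. -/
theorem gammaS_zero_pos {n : ℕ} (hn : 1 ≤ n) : 0 < gammaS n 0 := by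
  have hword : ∀ i < n, word (1 : Equiv.Perm (Fin n)) i = i := fun i hi => by
    simp [word_of_lt _ hi]
  have hdw : descWord (1 : Equiv.Perm (Fin n)) = List.replicate (n - 1) false := by
    refine List.eq_replicate_iff.2 ⟨length_descWord _, fun f hf => ?_⟩
    obtain ⟨i, hi, rfl⟩ := List.mem_map.1 hf
    rw [List.mem_range] at hi
    rw [hword i (by omega), hword (i + 1) (by omega)]
    simp
  have hdes : des (1 : Equiv.Perm (Fin n)) = 0 := by
    rw [des_eq_count hn, hdw]
    simp [List.count_replicate]
  refine Finset.card_pos.2 ⟨1, ?_⟩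
  rw [Finset.mem_filter]
  refine ⟨?_, ?_, hdes⟩
  · rw [mem_separable_iff]
    intro a b c d hab hbc hcd hd
    rw [hword a (by omega), hword b (by omega), hword c (by omega), hword d hd]
    omega
  · refine Nat.le_zero.1 (le_trans (Finset.card_le_card ?_) hdes.le)
    intro i hi
    rw [Finset.mem_filter] at hi ⊢
    exact ⟨hi.1, hi.2.2⟩

/-! ### Palindromicity and unimodality from a γ-expansion -/

section GammaExpansion

variable {m : ℕ} {γ : ℕ → ℤ} {p : ℤ[X]}

theorem coeff_of_gammaExpansion
    (hp : p = ∑ k ∈ Finset.range (m / 2 + 1), C (γ k) * X ^ k * (1 + X) ^ (m - 2 * k)) (j : ℕ) :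
    p.coeff j = ∑ k ∈ Finset.range (m / 2 + 1),
      γ k * if k ≤ j then ((m - 2 * k).choose (j - k) : ℤ) else 0 := by
  rw [hp, finsetSum_coeff]
  refine Finset.sum_congr rfl fun k _ => ?_
  rw [mul_assoc, coeff_C_mul, coeff_X_pow_mul']
  split_ifs
  · rw [coeff_one_add_X_pow]
  · rfl

theorem coeff_symm_of_gammaExpansion
    (hp : p = ∑ k ∈ Finset.range (m / 2 + 1), C (γ k) * X ^ k * (1 + X) ^ (m - 2 * k)) {j : ℕ}
    (hj : j ≤ m) : p.coeff (m - j) = p.coeff j := by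
  rw [coeff_of_gammaExpansion hp, coeff_of_gammaExpansion hp]
  refine Finset.sum_congr rfl fun k hk => ?_
  rw [Finset.mem_range] at hk
  congr 1
  by_cases h1 : k ≤ j <;> by_cases h2 : k ≤ m - j
  · rw [if_pos h1, if_pos h2, Nat.choose_symm_of_eq_add]
    omega
  -- Here `j - k > m - 2 * k`, so the binomial coefficient vanishes.
  · rw [if_pos h1, if_neg h2, Nat.choose_eq_zero_of_lt (by omega), Nat.cast_zero]
  · rw [if_neg h1, if_pos h2, Nat.choose_eq_zero_of_lt (by omega), Nat.cast_zero]
  · rw [if_neg h1, if_neg h2]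

theorem coeff_le_coeff_succ_of_gammaExpansion (hγ : ∀ k, 0 ≤ γ k)
    (hp : p = ∑ k ∈ Finset.range (m / 2 + 1), C (γ k) * X ^ k * (1 + X) ^ (m - 2 * k)) {j : ℕ}
    (hj : j < m / 2) : p.coeff j ≤ p.coeff (j + 1) := by
  rw [coeff_of_gammaExpansion hp, coeff_of_gammaExpansion hp]
  refine Finset.sum_le_sum fun k hk => mul_le_mul_of_nonneg_left ?_ (hγ k)
  by_cases h1 : k ≤ j
  · rw [if_pos h1, if_pos (by omega), Nat.succ_sub h1]
    exact_mod_cast Nat.choose_le_succ_of_lt_half_left (by omega)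
  · rw [if_neg h1]
    split_ifs <;> positivity

theorem coeff_zero_of_gammaExpansion
    (hp : p = ∑ k ∈ Finset.range (m / 2 + 1), C (γ k) * X ^ k * (1 + X) ^ (m - 2 * k)) :
    p.coeff 0 = γ 0 := by
  rw [coeff_of_gammaExpansion hp, Finset.sum_eq_single 0] <;> simp
  intro k _ hk hk'
  exact absurd hk' hk

theorem natDegree_of_gammaExpansion (h0 : γ 0 ≠ 0)
    (hp : p = ∑ k ∈ Finset.range (m / 2 + 1), C (γ k) * X ^ k * (1 + X) ^ (m - 2 * k)) :
    p.natDegree = m := by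
  refine natDegree_eq_of_le_of_coeff_ne_zero (natDegree_le_iff_coeff_eq_zero.2 fun j hj => ?_) ?_
  · rw [coeff_of_gammaExpansion hp]
    refine Finset.sum_eq_zero fun k hk => ?_
    rw [Finset.mem_range] at hk
    rw [Nat.choose_eq_zero_of_lt (by omega)]
    simp
  · have := coeff_symm_of_gammaExpansion hp (Nat.zero_le m)
    rw [Nat.sub_zero] at this
    rwa [this, coeff_zero_of_gammaExpansion hp]

theorem natTrailingDegree_of_gammaExpansion (h0 : γ 0 ≠ 0)
    (hp : p = ∑ k ∈ Finset.range (m / 2 + 1), C (γ k) * X ^ k * (1 + X) ^ (m - 2 * k)) :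
    p.natTrailingDegree = 0 :=
  natTrailingDegree_eq_zero_of_constantCoeff_ne_zero
    (by rwa [constantCoeff_apply, coeff_zero_of_gammaExpansion hp])

theorem isPalindromic_of_gammaExpansion (h0 : γ 0 ≠ 0)
    (hp : p = ∑ k ∈ Finset.range (m / 2 + 1), C (γ k) * X ^ k * (1 + X) ^ (m - 2 * k)) :
    IsPalindromic m p := by
  refine ⟨?_, ?_, ?_⟩
  · rintro rfl
    exact h0 (by rw [← coeff_zero_of_gammaExpansion hp, coeff_zero])
  · rw [natTrailingDegree_of_gammaExpansion h0 hp, natDegree_of_gammaExpansion h0 hp, zero_add]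
  · intro i hi
    rw [natTrailingDegree_of_gammaExpansion h0 hp, natDegree_of_gammaExpansion h0 hp] at *
    rw [zero_add, coeff_symm_of_gammaExpansion hp hi]

theorem isGammaPositive_of_gammaExpansion (hγ : ∀ k, 0 ≤ γ k) (h0 : γ 0 ≠ 0)
    (hp : p = ∑ k ∈ Finset.range (m / 2 + 1), C (γ k) * X ^ k * (1 + X) ^ (m - 2 * k)) :
    IsGammaPositive m p := by
  refine ⟨isPalindromic_of_gammaExpansion h0 hp, γ, hγ, ?_⟩
  rw [natTrailingDegree_of_gammaExpansion h0 hp, ← Nat.range_succ_eq_Icc_zero]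
  exact hp

theorem isUnimodal_of_gammaExpansion (hγ : ∀ k, 0 ≤ γ k) (h0 : γ 0 ≠ 0)
    (hp : p = ∑ k ∈ Finset.range (m / 2 + 1), C (γ k) * X ^ k * (1 + X) ^ (m - 2 * k)) :
    IsUnimodal p := by
  rw [IsUnimodal, natDegree_of_gammaExpansion h0 hp]
  refine ⟨m / 2, Nat.div_le_self m 2,
    fun i hi => coeff_le_coeff_succ_of_gammaExpansion hγ hp hi, fun i hi him => ?_⟩
  rw [← coeff_symm_of_gammaExpansion hp him, ← coeff_symm_of_gammaExpansion hp him.le]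
  rcases Nat.lt_or_ge (m - (i + 1)) (m / 2) with h | h
  · rw [show m - i = m - (i + 1) + 1 by omega]
    exact coeff_le_coeff_succ_of_gammaExpansion hγ hp h
  -- This occurs only for odd `m` and `i = m / 2`, where the two middle coefficients are equal by
  -- symmetry.
  · rw [← coeff_symm_of_gammaExpansion hp (Nat.sub_le m i), show m - (m - i) = m - (i + 1) by omega]

end GammaExpansion

end SeparablePerm

theorem theorem1 (n : ℕ) (hn : 1 ≤ n) :
    DescentPoly.sepPoly n =
        ∑ k ∈ Finset.range ((n - 1) / 2 + 1),
          C (DescentPoly.gammaS n k : ℤ) * X ^ k * (1 + X) ^ (n - 1 - 2 * k) ∧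
      DescentPoly.IsGammaPositive (n - 1) (DescentPoly.sepPoly n) ∧
      DescentPoly.IsPalindromic (n - 1) (DescentPoly.sepPoly n) ∧
      DescentPoly.IsUnimodal (DescentPoly.sepPoly n) := by
  have hp := SeparablePerm.sepPoly_eq hn
  have hγ : ∀ k, 0 ≤ (DescentPoly.gammaS n k : ℤ) := fun k => Int.natCast_nonneg _
  have h0 : (DescentPoly.gammaS n 0 : ℤ) ≠ 0 := by
    exact_mod_cast (SeparablePerm.gammaS_zero_pos hn).ne'
  let γ : ℕ → ℤ := fun k => DescentPoly.gammaS n k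
  exact ⟨hp, SeparablePerm.isGammaPositive_of_gammaExpansion (γ := γ) hγ h0 hp,
    SeparablePerm.isPalindromic_of_gammaExpansion (γ := γ) h0 hp,
    SeparablePerm.isUnimodal_of_gammaExpansion (γ := γ) hγ h0 hp⟩
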